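/- Let $\mathbb N=\{1,2,\dots\}$ and $[k]=\{1,\dots,k\}$. Posets are non-empty and are described by their strict order; $Q^\circ$ denotes the ground set of $Q$ and $<_Q$ its order. For posets $P,Q$ write $P\supset Q$ if $Q^\circ\subseteq P^\circ$ and $x<_Q y\Rightarrow x<_P y$ for all $x,y\in Q^\circ$, and let $P|_A$ be the restriction of $P$ to $A\subseteq P^\circ$. The space $\mathcal P_{\mathbb N}$ of all labelled posets on $\mathbb N$ is regarded, through the indicators $\mathbf 1[i<_P j]$, as a subset of $\{0,1\}^{\mathbb N\times\mathbb N}$ with the product topology and its Borel $\sigma$-field. A random infinite poset is a random element of $\mathcal P_{\mathbb N}$; it (or its distribution) is exchangeable if its distribution is invariant under every permutation of $\mathbb N$. **Theorem 1.6.** Let $R$ be an exchangeable random infinite poset. Then the following are equivalent. (i) The distribution of $R$ is an extreme point of the set of exchangeable probability distributions on $\mathcal P_{\mathbb N}$. (ii) If $Q_1$ and $Q_2$ are two finite posets with disjoint ground sets contained in $\mathbb N$, then $$\mathbb P(R\supset Q_1\cup Q_2)=\mathbb P(R\supset Q_1)\,\mathbb P(R\supset Q_2),$$ where $Q_1\cup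 Q_2$ is the poset with ground set $Q_1^\circ\cup Q_2^\circ$ in which $x<y$ if and only if $x<_{Q_1}y$ or $x<_{Q_2}y$. (iii) The restrictions $R|_{[k]}$ and $R|_{[k+1,\infty)}$ are independent for every $k\in\mathbb N$. (iv) Let $\mathcal F_n$ be the $\sigma$-field generated by $R|_{[n,\infty)}$. The tail $\sigma$-field $\bigcap_{n=1}^\infty\mathcal F_n$ is trivial, i.e. contains only events of probability $0$ or $1$. -/

import Mathlib

open MeasureTheory ProbabilityTheory
open scoped NNReal

/-- A labelled poset with ground set `V`, given by its strict order relation `<`. -/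
@[ext]
structure LabelledPoset (V : Type*) where
  lt : V → V → Prop
  irrefl : ∀ x, ¬ lt x x
  trans : ∀ x y z, lt x y → lt y z → lt x z

namespace LabelledPoset

variable {V : Type*}

/-- The space of posets on `V` is seen as a subset of the product space `{0,1}^(V × V)` through the
indicators of `i < j`, and carries the trace of the product σ-field. For countable `V` this is the
Borel σ-field of the (compact metrizable) product topology. -/
instance instMeasurableSpace : MeasurableSpace (LabelledPoset V) :=
  MeasurableSpace.comap (fun P : LabelledPoset V => P.lt) inferInstance

theorem measurable_lt : Measurable (fun P : LabelledPoset V => P.lt) :=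
  comap_measurable _

/-- The poset with the indicator array `I (σ i) (σ j)`, where `I i j` is that of `P`. -/
def relabel (σ : Equiv.Perm V) (P : LabelledPoset V) : LabelledPoset V where
  lt i j := P.lt (σ i) (σ j)
  irrefl i := P.irrefl (σ i)
  trans i j k := P.trans (σ i) (σ j) (σ k)

/-- The restriction `P|_A` of a poset to a subset `A` of its ground set. -/
def restrict (P : LabelledPoset V) (A : Set V) : LabelledPoset A where
  lt i j := P.lt i j
  irrefl i := P.irrefl i
  trans i j k := P.trans i j k

/-- `P.Contains Q` says `P ⊃ Q`: the poset `Q`, whose ground set `A` is a subset of that of `P`, is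
a (not necessarily induced) subposet of `P`. -/
def Contains (P : LabelledPoset V) {A : Set V} (Q : LabelledPoset A) : Prop :=
  ∀ x y : A, Q.lt x y → P.lt x y

/-- The union `Q₁ ∪ Q₂` of two posets with disjoint ground sets: `x < y` if and only if `x < y` in
`Q₁` or `x < y` in `Q₂`. -/
def union {A₁ A₂ : Set V} (h : Disjoint A₁ A₂) (Q₁ : LabelledPoset A₁) (Q₂ : LabelledPoset A₂) :
    LabelledPoset (A₁ ∪ A₂ : Set V) where
  lt x y :=
    (∃ (hx : (x : V) ∈ A₁) (hy : (y : V) ∈ A₁), Q₁.lt ⟨x, hx⟩ ⟨y, hy⟩) ∨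
    (∃ (hx : (x : V) ∈ A₂) (hy : (y : V) ∈ A₂), Q₂.lt ⟨x, hx⟩ ⟨y, hy⟩)
  irrefl x := by
    rintro (⟨hx, _, hlt⟩ | ⟨hx, _, hlt⟩)
    · exact Q₁.irrefl _ hlt
    · exact Q₂.irrefl _ hlt
  trans x y z := by
    rintro (⟨hx, hy, h₁⟩ | ⟨hx, hy, h₁⟩) (⟨hy', hz, h₂⟩ | ⟨hy', hz, h₂⟩)
    · exact Or.inl ⟨hx, hz, Q₁.trans _ _ _ h₁ h₂⟩
    · exact (Set.disjoint_left.mp h hy hy').elim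
    · exact (Set.disjoint_left.mp h hy' hy).elim
    · exact Or.inr ⟨hx, hz, Q₂.trans _ _ _ h₁ h₂⟩

theorem measurable_relabel (σ : Equiv.Perm V) :
    Measurable (relabel σ : LabelledPoset V → LabelledPoset V) := by
  refine measurable_comap_iff.mpr (measurable_pi_lambda _ fun i => measurable_pi_lambda _ fun j => ?_)
  exact (measurable_pi_apply (σ j)).comp ((measurable_pi_apply (σ i)).comp measurable_lt)

theorem measurable_restrict (A : Set V) :
    Measurable (fun P : LabelledPoset V => P.restrict A) := by
  refine measurable_comap_iff.mpr (measurable_pi_lambda _ fun i => measurable_pi_lambda _ fun j => ?_)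
  exact (measurable_pi_apply (j : V)).comp ((measurable_pi_apply (i : V)).comp measurable_lt)

end LabelledPoset

/-- The set of exchangeable distributions on the space of all labelled posets on `{1, 2, …}`: the
probability measures that are invariant under every permutation of the labels. -/
def exchangeableLaws : Set (Measure (LabelledPoset ℕ+)) :=
  {ν | IsProbabilityMeasure ν ∧ ∀ σ : Equiv.Perm ℕ+, ν.map (LabelledPoset.relabel σ) = ν}

/-- The σ-field on `Ω` generated by the restriction of the random poset `R` to `[n, ∞)`. -/
@[reducible]
def sigmaFrom {Ω : Type*} (R : Ω → LabelledPoset ℕ+) (n : ℕ+) : MeasurableSpace Ω :=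
  MeasurableSpace.comap (fun ω => (R ω).restrict (Set.Ici n)) inferInstance

/-- The tail σ-field of the random poset `R`. -/
@[reducible]
def tailSigma {Ω : Type*} (R : Ω → LabelledPoset ℕ+) : MeasurableSpace Ω :=
  ⨅ n : ℕ+, sigmaFrom R n

/-! The implications form the cycle (i) ⇒ (iii) ⇒ (iv) ⇒ (i) together with (ii) ⇔ (iii). For (i) ⇒
(iii), condition on an event `D` about the labels up to `k`, then delete those labels. The laws
given `D` and given `Dᶜ` stay exchangeable, and their mixture with weights `ν D`, `ν Dᶜ` is `ν`
itself. Extremality forces both to equal `ν`, which is independence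
(`measure_inter_eq_mul_of_mem_extremePoints`). (iii) ⇒ (iv) is Kolmogorov's zero-one law. For (iv) ⇒
(i), shift-invariant events are tail events, so the shift is ergodic; any component of a convex
decomposition is shift-invariant and absolutely continuous, hence equal to the whole. (ii) ⇔ (iii)
holds because the events listing finitely many relations form a generating π-system, and each
non-empty one says that some finite poset is contained. -/

namespace LabelledPoset

/-! ### Pull-backs of posets and the π-system of relation cylinders -/

variable {V W : Type*}

/-- The poset on `W` obtained by pulling back the order of `P` along `f : W → V`. Relabelling and
restriction are special cases. -/
def comap (f : W → V) (P : LabelledPoset V) : LabelledPoset W where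
  lt i j := P.lt (f i) (f j)
  irrefl i := P.irrefl (f i)
  trans i j k := P.trans (f i) (f j) (f k)

theorem measurable_comap (f : W → V) : Measurable (comap f) := by
  refine measurable_comap_iff.mpr (measurable_pi_lambda _ fun i => measurable_pi_lambda _ fun j => ?_)
  exact (measurable_pi_apply (f j)).comp ((measurable_pi_apply (f i)).comp measurable_lt)

/-- The event that a poset contains all the relations listed in `S`. -/
def relCylinder (S : Set (V × V)) : Set (LabelledPoset V) :=
  {P | ∀ p ∈ S, P.lt p.1 p.2}

theorem relCylinder_union (S T : Set (V × V)) :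
    relCylinder (S ∪ T) = relCylinder S ∩ relCylinder T := by
  ext P
  simp only [relCylinder, Set.mem_union, Set.mem_inter_iff, Set.mem_ofPred_eq]
  exact ⟨fun h => ⟨fun p hp => h p (.inl hp), fun p hp => h p (.inr hp)⟩,
    fun h p hp => hp.elim (h.1 p) (h.2 p)⟩

theorem preimage_comap_relCylinder (f : W → V) (S : Set (W × W)) :
    comap f ⁻¹' relCylinder S = relCylinder (Prod.map f f '' S) := by
  ext P
  exact (Set.forall_mem_image (f := Prod.map f f) (s := S)
    (p := fun q : V × V => P.lt q.1 q.2)).symm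

theorem measurableSet_setOf_lt (i j : V) : MeasurableSet {P : LabelledPoset V | P.lt i j} :=
  measurableSet_setOfPred.mpr
    ((measurable_pi_apply j).comp ((measurable_pi_apply i).comp measurable_lt))

theorem measurableSet_relCylinder {S : Set (V × V)} (hS : S.Finite) :
    MeasurableSet (relCylinder S) := by
  have : relCylinder S = ⋂ p ∈ S, {P : LabelledPoset V | P.lt p.1 p.2} := by
    ext P; simp [relCylinder]
  rw [this]
  exact hS.measurableSet_biInter fun p _ => measurableSet_setOf_lt p.1 p.2

/-- The cylinder events that list finitely many relations. -/
def relCylinders (V : Type*) : Set (Set (LabelledPoset V)) :=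
  relCylinder '' {S : Set (V × V) | S.Finite}

theorem isPiSystem_relCylinders : IsPiSystem (relCylinders V) := by
  rintro _ ⟨S, hS, rfl⟩ _ ⟨T, hT, rfl⟩ _
  exact ⟨S ∪ T, Set.Finite.union hS hT, relCylinder_union S T⟩

theorem generateFrom_relCylinders :
    MeasurableSpace.generateFrom (relCylinders V) = instMeasurableSpace := by
  apply le_antisymm
  · refine MeasurableSpace.generateFrom_le ?_
    rintro _ ⟨S, hS, rfl⟩
    exact measurableSet_relCylinder hS
  · refine measurable_iff_comap_le.mp ?_
    refine @measurable_pi_lambda _ _ _ (_) _ _ fun i => @measurable_pi_lambda _ _ _ (_) _ _ fun j => ?_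
    refine (@measurableSet_setOfPred _ (_) _).mp (MeasurableSpace.measurableSet_generateFrom ?_)
    refine ⟨{(i, j)}, Set.finite_singleton _, ?_⟩
    ext P
    simp [relCylinder]

theorem measure_ext_of_relCylinder {ν₁ ν₂ : Measure (LabelledPoset V)} [IsProbabilityMeasure ν₁]
    [IsProbabilityMeasure ν₂] (h : ∀ S : Set (V × V), S.Finite → ν₁ (relCylinder S) = ν₂ (relCylinder S)) :
    ν₁ = ν₂ := by
  refine ext_of_generate_finite (relCylinders V) generateFrom_relCylinders.symm isPiSystem_relCylinders ?_
    (by simp)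
  rintro _ ⟨S, hS, rfl⟩
  exact h S hS

/-- Containing `Q` means lying in the cylinder event of the relations of `Q`. -/
theorem setOf_contains_eq_relCylinder {A : Set V} (Q : LabelledPoset A) :
    {P : LabelledPoset V | P.Contains Q} =
      relCylinder (Prod.map (↑) (↑) '' {p : A × A | Q.lt p.1 p.2}) := by
  ext P
  refine Iff.trans ?_ (Set.forall_mem_image (p := fun q : V × V => P.lt q.1 q.2)).symm
  exact ⟨fun h p hp => h p.1 p.2 hp, fun h x y hxy => h (x := (x, y)) hxy⟩

theorem contains_union_iff {A₁ A₂ : Set V} (h : Disjoint A₁ A₂) (Q₁ : LabelledPoset A₁)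
    (Q₂ : LabelledPoset A₂) (P : LabelledPoset V) :
    P.Contains (union h Q₁ Q₂) ↔ P.Contains Q₁ ∧ P.Contains Q₂ := by
  constructor
  · intro hP
    exact ⟨fun x y hxy => hP ⟨x, .inl x.2⟩ ⟨y, .inl y.2⟩ (.inl ⟨x.2, y.2, hxy⟩),
      fun x y hxy => hP ⟨x, .inr x.2⟩ ⟨y, .inr y.2⟩ (.inr ⟨x.2, y.2, hxy⟩)⟩
  · rintro ⟨h₁, h₂⟩ x y (⟨hx, hy, hxy⟩ | ⟨hx, hy, hxy⟩)
    · exact h₁ _ _ hxy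
    · exact h₂ _ _ hxy

/-- A non-empty cylinder event on a set `A` of labels is the event of containing a poset on `A`,
namely the transitive closure of the listed relations. -/
theorem exists_relCylinder_eq_setOf_contains {A : Set V} {S : Set (V × V)} (hS : S ⊆ A ×ˢ A)
    (hne : (relCylinder S).Nonempty) :
    ∃ Q : LabelledPoset A, relCylinder S = {P | P.Contains Q} := by
  obtain ⟨P₀, hP₀⟩ := hne
  have key : ∀ P ∈ relCylinder S, ∀ x y : A,
      Relation.TransGen (fun x y : A => ((x : V), (y : V)) ∈ S) x y → P.lt x y := by
    intro P hP x y hxy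
    induction hxy with
    | single h => exact hP _ h
    | tail _ h ih => exact P.trans _ _ _ ih (hP _ h)
  -- A poset satisfying the relations rules out cycles, so the transitive closure is irreflexive.
  refine ⟨⟨Relation.TransGen fun x y : A => ((x : V), (y : V)) ∈ S,
    fun x hx => P₀.irrefl _ (key P₀ hP₀ x x hx), fun x y z => Relation.TransGen.trans⟩, ?_⟩
  ext P
  refine ⟨fun hP x y => key P hP x y, fun hP p hp => ?_⟩
  exact hP ⟨p.1, (hS hp).1⟩ ⟨p.2, (hS hp).2⟩ (.single hp)

end LabelledPoset

open LabelledPoset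

/-! ### Exchangeable laws: injective relabelling, conditioning, extremality -/

section Exchangeable

variable {ν : Measure (LabelledPoset ℕ+)}

/-- Under an exchangeable law, the probability of a cylinder event does not change when its labels
are moved by an injective map. -/
theorem measure_relCylinder_image (hν : ν ∈ exchangeableLaws) {A : Set ℕ+} (hA : A.Finite)
    {f : ℕ+ → ℕ+} (hf : Set.InjOn f A) {S : Set (ℕ+ × ℕ+)} (hS : S ⊆ A ×ˢ A) :
    ν (relCylinder (Prod.map f f '' S)) = ν (relCylinder S) := by
  have : Finite A := hA
  -- An injection of a finite set of labels extends to a permutation of all labels.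
  obtain ⟨σ, hσ⟩ := Equiv.Perm.exists_smul_eq_embedding
    (Function.Embedding.subtype (· ∈ A)) ⟨fun x : A => f x, hf.injective⟩
  have hσ' : ∀ x ∈ A, σ x = f x := fun x hx => DFunLike.congr_fun hσ ⟨x, hx⟩
  have himg : Prod.map f f '' S = Prod.map σ σ '' S :=
    Set.image_congr fun p hp => by
      rw [Prod.map_apply', Prod.map_apply', hσ' _ (hS hp).1, hσ' _ (hS hp).2]
  have hSf : S.Finite := (hA.prod hA).subset hS
  conv_rhs => rw [← hν.2 σ, Measure.map_apply (measurable_relabel σ) (measurableSet_relCylinder hSf)]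
  rw [himg, ← preimage_comap_relCylinder]
  rfl

/-- The map need not be surjective: a cylinder sees finitely many labels, and cylinders determine
the law. The case used is the shift `(· + k)`. -/
theorem measurePreserving_comap (hν : ν ∈ exchangeableLaws) {f : ℕ+ → ℕ+}
    (hf : Function.Injective f) : MeasurePreserving (comap f) ν ν := by
  have := hν.1
  refine ⟨measurable_comap f, ?_⟩
  have := Measure.isProbabilityMeasure_map (μ := ν) (measurable_comap f).aemeasurable
  refine measure_ext_of_relCylinder fun S hS => ?_
  rw [Measure.map_apply (measurable_comap f) (measurableSet_relCylinder hS), preimage_comap_relCylinder]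
  refine measure_relCylinder_image hν ((hS.image Prod.fst).union (hS.image Prod.snd)) hf.injOn ?_
  exact fun p hp => ⟨.inl ⟨p, hp, rfl⟩, .inr ⟨p, hp, rfl⟩⟩

/-- The permutation of `{1, 2, …}` that fixes `1, …, k` and acts as `σ` on the labels
shifted by `k`. -/
def shiftPerm (k : ℕ+) (σ : Equiv.Perm ℕ+) : Equiv.Perm ℕ+ where
  toFun i := if k < i then σ (i - k) + k else i
  invFun i := if k < i then σ.symm (i - k) + k else i
  left_inv i := by
    by_cases h : k < i
    · have h' : k < σ (i - k) + k := PNat.lt_add_left _ _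
      have e : σ (i - k) + k - k = σ (i - k) := PNat.add_sub
      beta_reduce
      rw [if_pos h, if_pos h', e, Equiv.symm_apply_apply, add_comm, PNat.add_sub_of_lt h]
    · simp [h]
  right_inv i := by
    by_cases h : k < i
    · have h' : k < σ.symm (i - k) + k := PNat.lt_add_left _ _
      have e : σ.symm (i - k) + k - k = σ.symm (i - k) := PNat.add_sub
      beta_reduce
      rw [if_pos h, if_pos h', e, Equiv.apply_symm_apply, add_comm, PNat.add_sub_of_lt h]
    · simp [h]

theorem shiftPerm_add (k : ℕ+) (σ : Equiv.Perm ℕ+) (i : ℕ+) :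
    shiftPerm k σ (i + k) = σ i + k := by
  have e : i + k - k = i := PNat.add_sub
  simp [shiftPerm, PNat.lt_add_left, e]

theorem shiftPerm_of_le {k : ℕ+} (σ : Equiv.Perm ℕ+) {i : ℕ+} (hi : i ≤ k) :
    shiftPerm k σ i = i := by
  simp [shiftPerm, hi.not_gt]

/-- Conditioning an exchangeable law on an event that depends on the first `k` labels only, and then
deleting these labels, yields an exchangeable law. -/
theorem map_cond_mem_exchangeableLaws (hν : ν ∈ exchangeableLaws) (k : ℕ+)
    {C : Set (LabelledPoset (Set.Iic k))} (hC : MeasurableSet C)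
    (h0 : ν ((restrict · (Set.Iic k)) ⁻¹' C) ≠ 0) :
    (ν[|(restrict · (Set.Iic k)) ⁻¹' C]).map (comap (· + k)) ∈ exchangeableLaws := by
  have := hν.1
  set D : Set (LabelledPoset ℕ+) := (restrict · (Set.Iic k)) ⁻¹' C with hD
  have hDm : MeasurableSet D := measurable_restrict _ hC
  have := cond_isProbabilityMeasure h0
  refine ⟨Measure.isProbabilityMeasure_map (measurable_comap _).aemeasurable, fun σ => ?_⟩
  -- `shiftPerm k σ` preserves the conditioning event and becomes `σ` once the first `k` labels are
  -- deleted.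
  have hpre : relabel (shiftPerm k σ) ⁻¹' D = D := by
    ext P
    have : (relabel (shiftPerm k σ) P).restrict (Set.Iic k) = P.restrict (Set.Iic k) := by
      ext i j
      simp only [restrict, relabel, shiftPerm_of_le σ i.2, shiftPerm_of_le σ j.2]
    simp only [hD, Set.mem_preimage, this]
  have hcomm : relabel σ ∘ comap (· + k) = comap (· + k) ∘ relabel (shiftPerm k σ) := by
    ext P i j
    simp only [Function.comp_apply, relabel, comap, shiftPerm_add]
  rw [Measure.map_map (measurable_relabel σ) (measurable_comap _), hcomm,
    ← Measure.map_map (measurable_comap _) (measurable_relabel _)]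
  congr 1
  ext s hs
  rw [Measure.map_apply (measurable_relabel _) hs, cond_apply hDm, cond_apply hDm]
  congr 1
  conv_lhs => rw [← hpre, ← Set.preimage_inter]
  rw [← Measure.map_apply (measurable_relabel _) (hDm.inter hs), hν.2]

/-- Extremality identifies the conditional law of the shifted poset given `D` with `ν`. If `D` is
null or conull, one of the two conditional laws is unavailable, but the product formula is
immediate. -/
theorem measure_inter_eq_mul_of_mem_extremePoints
    (hν : ν ∈ Set.extremePoints ℝ≥0 exchangeableLaws) (k : ℕ+)
    {C : Set (LabelledPoset (Set.Iic k))} (hC : MeasurableSet C) {B : Set (LabelledPoset ℕ+)}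
    (hB : MeasurableSet B) :
    ν ((restrict · (Set.Iic k)) ⁻¹' C ∩ comap (· + k) ⁻¹' B) =
      ν ((restrict · (Set.Iic k)) ⁻¹' C) * ν (comap (· + k) ⁻¹' B) := by
  have := hν.1.1
  have hmp := measurePreserving_comap hν.1 (f := (· + k)) (add_left_injective k)
  have hcond := map_cond_mem_exchangeableLaws hν.1 k hC
  have hcond' := map_cond_mem_exchangeableLaws hν.1 k hC.compl
  rw [Set.preimage_compl] at hcond'
  have hDm : MeasurableSet ((restrict · (Set.Iic k)) ⁻¹' C : Set (LabelledPoset ℕ+)) :=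
    measurable_restrict _ hC
  set D : Set (LabelledPoset ℕ+) := (restrict · (Set.Iic k)) ⁻¹' C
  by_cases h0 : ν D = 0
  · rw [h0, zero_mul, measure_inter_null_of_null_left _ h0]
  by_cases h1 : ν Dᶜ = 0
  · have hD1 : ν D = 1 := (prob_compl_eq_zero_iff hDm).mp h1
    rw [hD1, one_mul, Set.inter_comm]
    exact measure_inter_conull h1
  have heq := hν.2 (hcond h0) (hcond' h1) ⟨(ν D).toNNReal, (ν Dᶜ).toNNReal,
    ENNReal.toNNReal_pos h0 (measure_ne_top _ _), ENNReal.toNNReal_pos h1 (measure_ne_top _ _), ?_, ?_⟩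
  · have := congrArg (fun m => m B) heq
    simp only [Measure.map_apply (measurable_comap _) hB] at this
    rw [hmp.measure_preimage hB.nullMeasurableSet, ← this, mul_comm, cond_mul_eq_inter hDm]
  · rw [← ENNReal.toNNReal_add (measure_ne_top _ _) (measure_ne_top _ _),
      measure_add_measure_compl hDm, measure_univ, ENNReal.toNNReal_one]
  -- Law of total probability over `D` and `Dᶜ`, with the shift preserving `ν`.
  · ext s hs
    have hs' := measurable_comap (W := ℕ+) (· + k) hs
    simp only [Measure.add_apply, Measure.smul_apply, Measure.map_apply (measurable_comap _) hs,
      ENNReal.smul_def, smul_eq_mul, ENNReal.coe_toNNReal (measure_ne_top ν _)]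
    rw [mul_comm, cond_mul_eq_inter hDm, mul_comm, cond_mul_eq_inter hDm.compl,
      Set.inter_comm, Set.inter_comm Dᶜ, ← Set.sdiff_eq, measure_inter_add_sdiff _ hDm,
      hmp.measure_preimage hs.nullMeasurableSet]

end Exchangeable

/-! ### The implications for a random poset -/

section RandomPoset

variable {Ω : Type*} [MeasurableSpace Ω] {μ : Measure Ω} {R : Ω → LabelledPoset ℕ+}

theorem indepFun_restrict_of_mem_extremePoints (hR : Measurable R)
    (h : μ.map R ∈ Set.extremePoints ℝ≥0 exchangeableLaws) (k : ℕ+) :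
    IndepFun (fun ω => (R ω).restrict (Set.Iic k))
      (fun ω => (R ω).restrict (Set.Ici (k + 1))) μ := by
  have hshift : IndepFun (fun ω => (R ω).restrict (Set.Iic k)) (fun ω => comap (· + k) (R ω)) μ := by
    rw [indepFun_iff_measure_inter_preimage_eq_mul]
    intro C B hC hB
    have := measure_inter_eq_mul_of_mem_extremePoints h k hC hB
    have hC' := measurable_restrict (Set.Iic k) hC
    have hB' := measurable_comap (W := ℕ+) (· + k) hB
    rw [Measure.map_apply hR (hC'.inter hB'), Measure.map_apply hR hC',
      Measure.map_apply hR hB'] at this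
    exact this
  -- Subtracting `k` undoes the shift; the truncation of subtraction in `ℕ+` plays no role, as all
  -- labels here exceed `k`.
  have hcomp := hshift.comp measurable_id
    (measurable_comap fun i : Set.Ici (k + 1) => (i : ℕ+) - k)
  convert! hcomp using 1
  ext ω i j
  have hi : k < i := PNat.add_one_le_iff.mp i.2
  have hj : k < j := PNat.add_one_le_iff.mp j.2
  simp only [Function.comp_apply, restrict, comap, add_comm _ k, PNat.add_sub_of_lt hi,
    PNat.add_sub_of_lt hj]

/-- The tail is independent of every initial σ-field, hence of their supremum, which contains the
tail; so a tail event is independent of itself. -/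
theorem measure_tail_eq_zero_or_one_of_indepFun [IsProbabilityMeasure μ] (hR : Measurable R)
    (h : ∀ k : ℕ+, IndepFun (fun ω => (R ω).restrict (Set.Iic k))
      (fun ω => (R ω).restrict (Set.Ici (k + 1))) μ)
    {E : Set Ω} (hE : MeasurableSet[tailSigma R] E) : μ E = 0 ∨ μ E = 1 := by
  have hfrom : ∀ n, sigmaFrom R n ≤ MeasurableSpace.comap R inferInstance := fun n => by
    refine measurable_iff_comap_le.mp ?_
    exact (measurable_restrict _).comp (comap_measurable R)
  have htail : tailSigma R ≤ MeasurableSpace.comap R inferInstance :=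
    (iInf_le _ 1).trans (hfrom 1)
  let m : ℕ+ → MeasurableSpace Ω := fun k =>
    MeasurableSpace.comap (fun ω => (R ω).restrict (Set.Iic k)) inferInstance
  have hm : Monotone m := fun k l hkl => by
    refine measurable_iff_comap_le.mp ?_
    exact (measurable_comap fun i : Set.Iic k => (⟨i, i.2.trans hkl⟩ : Set.Iic l)).comp
      (comap_measurable fun ω => (R ω).restrict (Set.Iic l))
  have hsup : MeasurableSpace.comap R inferInstance ≤ ⨆ k, m k := by
    refine measurable_iff_comap_le.mp ?_
    refine (@measurable_comap_iff _ _ _ (_) _ _ _).mpr ?_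
    refine @measurable_pi_lambda _ _ _ (_) _ _ fun i => @measurable_pi_lambda _ _ _ (_) _ _ fun j => ?_
    refine (@measurableSet_setOfPred _ (_) _).mp (le_iSup m (max i j) _ ?_)
    exact ⟨{P | P.lt ⟨i, le_max_left i j⟩ ⟨j, le_max_right i j⟩}, measurableSet_setOf_lt _ _, rfl⟩
  have hind : Indep (⨆ k, m k) (tailSigma R) μ := by
    refine indep_iSup_of_monotone (fun k => ?_) (fun k => ?_) (htail.trans hR.comap_le) hm
    · exact indep_of_indep_of_le_right (h k) (iInf_le _ (k + 1))
    · exact ((measurable_restrict _).comp hR).comap_le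
  exact measure_eq_zero_or_one_of_indepSet_self
    (hind.indepSet_of_measurableSet (htail.trans hsup _ hE) hE)

theorem mem_extremePoints_of_tail_trivial [IsProbabilityMeasure μ] (hR : Measurable R)
    (hexch : μ.map R ∈ exchangeableLaws)
    (h : ∀ E : Set Ω, MeasurableSet[tailSigma R] E → μ E = 0 ∨ μ E = 1) :
    μ.map R ∈ Set.extremePoints ℝ≥0 exchangeableLaws := by
  have := hexch.1
  have herg : Ergodic (comap (· + 1)) (μ.map R) := by
    refine ⟨measurePreserving_comap hexch (add_left_injective 1), ⟨fun s hs hinv => ?_⟩⟩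
    -- Invariance under the unit shift gives invariance under every shift, so the event depends only
    -- on labels beyond `n`, for each `n`.
    have hn : ∀ n : ℕ+, comap (· + n) ⁻¹' s = s := fun n => by
      induction n with
      | one => exact hinv
      | succ n ih =>
        conv_rhs => rw [← ih, ← hinv]
        ext P
        simp only [Set.mem_preimage, comap, add_assoc, add_comm 1 n]
    have htail : MeasurableSet[tailSigma R] (R ⁻¹' s) := by
      refine MeasurableSpace.measurableSet_iInf.mpr fun n => ?_
      refine ⟨comap (fun i : ℕ+ => (⟨i + n, (PNat.lt_add_left n i).le⟩ : Set.Ici n)) ⁻¹' s,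
        measurable_comap _ hs, ?_⟩
      conv_rhs => rw [← hn n]
      rfl
    rw [Filter.eventuallyConst_set']
    rcases h _ htail with h0 | h1
    · left
      rwa [ae_eq_empty, Measure.map_apply hR hs]
    · right
      rw [ae_eq_univ, prob_compl_eq_zero_iff hs, Measure.map_apply hR hs]
      exact h1
  refine ⟨hexch, ?_⟩
  rintro ν₁ hν₁ ν₂ hν₂ ⟨a, b, ha, hb, hab, hsum⟩
  have := hν₁.1
  -- An invariant probability measure absolutely continuous with respect to an ergodic one equals
  -- it.
  refine herg.eq_of_absolutelyContinuous
    (measurePreserving_comap hν₁ (add_left_injective 1)) ?_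
  rw [← hsum]
  refine Measure.AbsolutelyContinuous.add_right ?_ _
  exact Measure.absolutelyContinuous_smul (ENNReal.coe_ne_zero.mpr ha.ne')

theorem measure_contains_union_of_indepFun (hR : Measurable R) (hexch : μ.map R ∈ exchangeableLaws)
    (h : ∀ k : ℕ+, IndepFun (fun ω => (R ω).restrict (Set.Iic k))
      (fun ω => (R ω).restrict (Set.Ici (k + 1))) μ)
    {A₁ A₂ : Set ℕ+} (hA₁ : A₁.Finite) (hA₂ : A₂.Finite) (hdisj : Disjoint A₁ A₂)
    (Q₁ : LabelledPoset A₁) (Q₂ : LabelledPoset A₂) :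
    μ {ω | (R ω).Contains (LabelledPoset.union hdisj Q₁ Q₂)} =
      μ {ω | (R ω).Contains Q₁} * μ {ω | (R ω).Contains Q₂} := by
  classical
  obtain ⟨k, hk⟩ := hA₁.bddAbove
  -- `f` fixes `A₁`, which lies in `[1, k]`, and pushes `A₂` beyond `k`. It is injective on `A₁ ∪
  -- A₂`, which suffices for exchangeability to keep all three probabilities.
  let f : ℕ+ → ℕ+ := fun i => if i ∈ A₁ then i else i + k
  have hf₁ : ∀ i ∈ A₁, f i = i := fun i hi => by simp [f, hi]
  have hf₂ : ∀ i ∈ A₂, f i = i + k := fun i hi => by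
    simp [f, Set.disjoint_right.mp hdisj hi]
  have hlt : ∀ i ∈ A₁, ∀ j, i < j + k := fun i hi j => (hk hi).trans_lt (PNat.lt_add_left k j)
  have hinj : Set.InjOn f (A₁ ∪ A₂) := by
    rintro i (hi | hi) j (hj | hj) hij
    · rwa [hf₁ i hi, hf₁ j hj] at hij
    · rw [hf₁ i hi, hf₂ j hj] at hij
      exact absurd hij (hlt i hi j).ne
    · rw [hf₂ i hi, hf₁ j hj] at hij
      exact absurd hij (hlt j hj i).ne'
    · rw [hf₂ i hi, hf₂ j hj] at hij
      exact add_right_cancel hij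
  set S₁ : Set (ℕ+ × ℕ+) := Prod.map (↑) (↑) '' {p : A₁ × A₁ | Q₁.lt p.1 p.2} with hS₁
  set S₂ : Set (ℕ+ × ℕ+) := Prod.map (↑) (↑) '' {p : A₂ × A₂ | Q₂.lt p.1 p.2} with hS₂
  have hSA₁ : S₁ ⊆ A₁ ×ˢ A₁ := by rintro _ ⟨p, _, rfl⟩; exact ⟨p.1.2, p.2.2⟩
  have hSA₂ : S₂ ⊆ A₂ ×ˢ A₂ := by rintro _ ⟨p, _, rfl⟩; exact ⟨p.1.2, p.2.2⟩
  have hmono₁ : A₁ ×ˢ A₁ ⊆ (A₁ ∪ A₂) ×ˢ (A₁ ∪ A₂) :=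
    Set.prod_mono Set.subset_union_left Set.subset_union_left
  have hmono₂ : A₂ ×ˢ A₂ ⊆ (A₁ ∪ A₂) ×ˢ (A₁ ∪ A₂) :=
    Set.prod_mono Set.subset_union_right Set.subset_union_right
  have hmove : ∀ S ⊆ (A₁ ∪ A₂) ×ˢ (A₁ ∪ A₂),
      μ (R ⁻¹' relCylinder S) = μ (R ⁻¹' (comap f ⁻¹' relCylinder S)) := fun S hS => by
    have hSf : S.Finite := ((hA₁.union hA₂).prod (hA₁.union hA₂)).subset hS
    have := measure_relCylinder_image hexch (hA₁.union hA₂) hinj hS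
    rw [← preimage_comap_relCylinder,
      Measure.map_apply hR (measurable_comap f (measurableSet_relCylinder hSf)),
      Measure.map_apply hR (measurableSet_relCylinder hSf)] at this
    exact this.symm
  have h₁ : {ω | (R ω).Contains Q₁} = R ⁻¹' relCylinder S₁ := by
    rw [hS₁, ← setOf_contains_eq_relCylinder]; rfl
  have h₂ : {ω | (R ω).Contains Q₂} = R ⁻¹' relCylinder S₂ := by
    rw [hS₂, ← setOf_contains_eq_relCylinder]; rfl
  have h₁₂ : {ω | (R ω).Contains (LabelledPoset.union hdisj Q₁ Q₂)} =
      R ⁻¹' relCylinder (S₁ ∪ S₂) := by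
    rw [relCylinder_union, Set.preimage_inter, ← h₁, ← h₂]
    ext ω
    exact contains_union_iff hdisj Q₁ Q₂ (R ω)
  rw [h₁₂, h₁, h₂, hmove _ (Set.union_subset (hSA₁.trans hmono₁) (hSA₂.trans hmono₂)),
    hmove _ (hSA₁.trans hmono₁), hmove _ (hSA₂.trans hmono₂), relCylinder_union]
  have hres₁ : R ⁻¹' (comap f ⁻¹' relCylinder S₁) =
      (fun ω => (R ω).restrict (Set.Iic k)) ⁻¹' {P | ∀ p : A₁ × A₁, Q₁.lt p.1 p.2 →
        P.lt ⟨p.1, hk p.1.2⟩ ⟨p.2, hk p.2.2⟩} := by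
    ext ω
    refine (Set.forall_mem_image (p := fun q : ℕ+ × ℕ+ => (R ω).lt (f q.1) (f q.2))).trans ?_
    refine forall_congr' fun p => imp_congr_right fun _ => ?_
    simp only [Prod.map_fst, Prod.map_snd, hf₁ _ p.1.2, hf₁ _ p.2.2, restrict]
  have hge : ∀ j, j + k ∈ Set.Ici (k + 1) := fun j =>
    PNat.add_one_le_iff.mpr (PNat.lt_add_left k j)
  have hres₂ : R ⁻¹' (comap f ⁻¹' relCylinder S₂) =
      (fun ω => (R ω).restrict (Set.Ici (k + 1))) ⁻¹' {P | ∀ p : A₂ × A₂, Q₂.lt p.1 p.2 →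
        P.lt ⟨p.1 + k, hge p.1⟩ ⟨p.2 + k, hge p.2⟩} := by
    ext ω
    refine (Set.forall_mem_image (p := fun q : ℕ+ × ℕ+ => (R ω).lt (f q.1) (f q.2))).trans ?_
    refine forall_congr' fun p => imp_congr_right fun _ => ?_
    simp only [Prod.map_fst, Prod.map_snd, hf₂ _ p.1.2, hf₂ _ p.2.2, restrict]
  rw [Set.preimage_inter, Set.preimage_inter, hres₁, hres₂]
  refine (h k).measure_inter_preimage_eq_mul _ _ ?_ ?_
  · simp only [Set.ofPred_forall]
    exact MeasurableSet.iInter fun p => MeasurableSet.iInter fun _ => measurableSet_setOf_lt _ _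
  · simp only [Set.ofPred_forall]
    exact MeasurableSet.iInter fun p => MeasurableSet.iInter fun _ => measurableSet_setOf_lt _ _

/-- The product formula for disjoint posets extends to cylinder events on disjoint label sets. -/
theorem measure_relCylinder_inter_of_contains
    (h : ∀ (A₁ A₂ : Set ℕ+) (_ : A₁.Finite) (_ : A₂.Finite) (_ : A₁.Nonempty) (_ : A₂.Nonempty)
      (hdisj : Disjoint A₁ A₂) (Q₁ : LabelledPoset A₁) (Q₂ : LabelledPoset A₂),
      μ {ω | (R ω).Contains (LabelledPoset.union hdisj Q₁ Q₂)} =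
        μ {ω | (R ω).Contains Q₁} * μ {ω | (R ω).Contains Q₂})
    {B₁ B₂ : Set ℕ+} (hB₁ : B₁.Nonempty) (hB₂ : B₂.Nonempty) (hdisj : Disjoint B₁ B₂)
    {S₁ S₂ : Set (ℕ+ × ℕ+)} (hS₁ : S₁.Finite) (hS₂ : S₂.Finite) (hSB₁ : S₁ ⊆ B₁ ×ˢ B₁)
    (hSB₂ : S₂ ⊆ B₂ ×ˢ B₂) :
    μ (R ⁻¹' relCylinder S₁ ∩ R ⁻¹' relCylinder S₂) =
      μ (R ⁻¹' relCylinder S₁) * μ (R ⁻¹' relCylinder S₂) := by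
  have hsupp : ∀ {B : Set ℕ+} {S : Set (ℕ+ × ℕ+)}, B.Nonempty → S.Finite → S ⊆ B ×ˢ B →
      ∃ A ⊆ B, A.Finite ∧ A.Nonempty ∧ S ⊆ A ×ˢ A := by
    rintro B S ⟨b, hb⟩ hS hSB
    -- Inserting `b` keeps the ground set non-empty even when no relation is listed.
    refine ⟨insert b (Prod.fst '' S ∪ Prod.snd '' S), ?_,
      ((hS.image _).union (hS.image _)).insert b, Set.insert_nonempty _ _, fun p hp =>
        ⟨.inr (.inl ⟨p, hp, rfl⟩), .inr (.inr ⟨p, hp, rfl⟩)⟩⟩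
    rintro _ (rfl | ⟨p, hp, rfl⟩ | ⟨p, hp, rfl⟩)
    exacts [hb, (hSB hp).1, (hSB hp).2]
  obtain ⟨A₁, hAB₁, hA₁, hne₁, hSA₁⟩ := hsupp hB₁ hS₁ hSB₁
  obtain ⟨A₂, hAB₂, hA₂, hne₂, hSA₂⟩ := hsupp hB₂ hS₂ hSB₂
  -- Contradictory relations come from no poset, but then both sides vanish.
  rcases (relCylinder S₁).eq_empty_or_nonempty with h₁ | h₁
  · simp [h₁]
  rcases (relCylinder S₂).eq_empty_or_nonempty with h₂ | h₂
  · simp [h₂]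
  obtain ⟨Q₁, hQ₁⟩ := exists_relCylinder_eq_setOf_contains hSA₁ h₁
  obtain ⟨Q₂, hQ₂⟩ := exists_relCylinder_eq_setOf_contains hSA₂ h₂
  have := h A₁ A₂ hA₁ hA₂ hne₁ hne₂ (hdisj.mono hAB₁ hAB₂) Q₁ Q₂
  simp only [contains_union_iff, Set.ofPred_and] at this
  rw [hQ₁, hQ₂]
  exact this

theorem indepFun_restrict_of_contains [IsProbabilityMeasure μ] (hR : Measurable R)
    (h : ∀ (A₁ A₂ : Set ℕ+) (_ : A₁.Finite) (_ : A₂.Finite) (_ : A₁.Nonempty) (_ : A₂.Nonempty)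
      (hdisj : Disjoint A₁ A₂) (Q₁ : LabelledPoset A₁) (Q₂ : LabelledPoset A₂),
      μ {ω | (R ω).Contains (LabelledPoset.union hdisj Q₁ Q₂)} =
        μ {ω | (R ω).Contains Q₁} * μ {ω | (R ω).Contains Q₂}) (k : ℕ+) :
    IndepFun (fun ω => (R ω).restrict (Set.Iic k))
      (fun ω => (R ω).restrict (Set.Ici (k + 1))) μ := by
  have hgen : ∀ B : Set ℕ+, MeasurableSpace.comap (fun ω => (R ω).restrict B) inferInstance =
      MeasurableSpace.generateFrom
        (Set.preimage (fun ω => (R ω).restrict B) '' relCylinders B) := fun B => by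
    rw [← MeasurableSpace.comap_generateFrom, generateFrom_relCylinders]
  have hpi : ∀ B : Set ℕ+,
      IsPiSystem (Set.preimage (fun ω => (R ω).restrict B) '' relCylinders B) := fun B =>
    isPiSystem_relCylinders.comap _
  refine IndepSets.indep ((measurable_restrict _).comp hR).comap_le
    ((measurable_restrict _).comp hR).comap_le (hpi _) (hpi _) (hgen _) (hgen _) ?_
  rw [IndepSets_iff]
  rintro _ _ ⟨_, ⟨S₁, hS₁, rfl⟩, rfl⟩ ⟨_, ⟨S₂, hS₂, rfl⟩, rfl⟩
  have hpre : ∀ {B : Set ℕ+} (S : Set (B × B)), (fun ω => (R ω).restrict B) ⁻¹' relCylinder S =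
      R ⁻¹' relCylinder (Prod.map (↑) (↑) '' S) := fun S => by
    rw [← preimage_comap_relCylinder]; rfl
  have hsub : ∀ {B : Set ℕ+} (S : Set (B × B)),
      (Prod.map (↑) (↑) '' S : Set (ℕ+ × ℕ+)) ⊆ B ×ˢ B := by
    rintro B S _ ⟨p, _, rfl⟩
    exact ⟨p.1.2, p.2.2⟩
  rw [hpre, hpre]
  refine measure_relCylinder_inter_of_contains h Set.nonempty_Iic Set.nonempty_Ici ?_
    (Set.Finite.image _ hS₁) (Set.Finite.image _ hS₂) (hsub S₁) (hsub S₂)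
  rw [Set.disjoint_left]
  exact fun i hi hi' => (PNat.add_one_le_iff.mp hi').not_ge hi

end RandomPoset

theorem theorem1p6 {Ω : Type*} [MeasurableSpace Ω] (μ : Measure Ω) [IsProbabilityMeasure μ]
    (R : Ω → LabelledPoset ℕ+) (hR : Measurable R) (hexch : μ.map R ∈ exchangeableLaws) :
    List.TFAE [
      μ.map R ∈ Set.extremePoints ℝ≥0 exchangeableLaws,
      ∀ (A₁ A₂ : Set ℕ+) (_ : A₁.Finite) (_ : A₂.Finite) (_ : A₁.Nonempty) (_ : A₂.Nonempty)
        (hdisj : Disjoint A₁ A₂) (Q₁ : LabelledPoset A₁) (Q₂ : LabelledPoset A₂),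
        μ {ω | (R ω).Contains (LabelledPoset.union hdisj Q₁ Q₂)} =
          μ {ω | (R ω).Contains Q₁} * μ {ω | (R ω).Contains Q₂},
      ∀ k : ℕ+, IndepFun (fun ω => (R ω).restrict (Set.Iic k))
        (fun ω => (R ω).restrict (Set.Ici (k + 1))) μ,
      ∀ E : Set Ω, MeasurableSet[tailSigma R] E → μ E = 0 ∨ μ E = 1] := by
  tfae_have 1 → 3 := fun h => indepFun_restrict_of_mem_extremePoints hR h
  tfae_have 3 → 4 := fun h _ hE => measure_tail_eq_zero_or_one_of_indepFun hR h hE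
  tfae_have 4 → 1 := mem_extremePoints_of_tail_trivial hR hexch
  tfae_have 3 → 2 := fun h _ _ hA₁ hA₂ _ _ hdisj Q₁ Q₂ =>
    measure_contains_union_of_indepFun hR hexch h hA₁ hA₂ hdisj Q₁ Q₂
  tfae_have 2 → 3 := indepFun_restrict_of_contains hR
  tfae_finish
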